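/- Let $\mathbb T=\{e^{i\theta}\}$ be the unit circle with normalized Lebesgue measure $d\theta/(2\pi)$, and for $f\in L^2(\mathbb T)$ with Fourier coefficients $\hat f(k)$ let $$Hf(\zeta)=-i\sum_{k\in\mathbb Z}\operatorname{sign}(k)\,\hat f(k)\,\zeta^k ,\qquad \operatorname{sign}(0)=0,$$ (convergence in $L^2(\mathbb T)$) be its Hilbert transform (conjugate function). For $2\le p<\infty$ let $\|H\|_{\infty,p}=\sup\{\|Hf\|_p:\ f\in L^\infty(\mathbb T),\ \|f\|_\infty\le 1\}$ be the norm of $H$ as an operator from the space $L^\infty(\mathbb T)$ of complex-valued functions to $L^p(\mathbb T)$, and let $\|H_{\mathbb R}\|_{\infty,p}$ be the norm of its restriction to real-valued functions, that is, the same supremum taken over real-valued $f$ only. Then $$\lim_{p\to\infty}\frac1p\,\|H\|_{\infty,p}=\lim_{p\to\infty}\frac1p\,\|H_{\mathbb R}\|_{\infty,p}=\frac{2}{\pi e}.$$ -/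

import Mathlib

open MeasureTheory Filter Topology
open scoped ENNReal Real

noncomputable section

/-- The period `2π` of the circle is positive. -/
instance fact_two_pi_pos : Fact (0 < 2 * π) := ⟨Real.two_pi_pos⟩

/-- Normalized Lebesgue measure `dθ / (2π)` on the circle `𝕋 = ℝ / 2πℤ`
(the point `θ` stands for `ζ = e^{iθ}`). -/
abbrev circleMeasure : Measure (AddCircle (2 * π)) := AddCircle.haarAddCircle

/-- The Hilbert transform (conjugation operator) on `L²(𝕋)`:
`H f = -i ∑_{k ∈ ℤ} sign(k) f̂(k) ζ^k`, the sum being taken in `L²(𝕋)`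
(it always converges, see `hasSum_hilbertTransform`). -/
def hilbertTransform (f : Lp ℂ 2 circleMeasure) : Lp ℂ 2 circleMeasure :=
  -Complex.I • ∑' k : ℤ, ((k.sign : ℂ) * fourierCoeff f k) • fourierLp 2 k

/-- The Fourier series defining the Hilbert transform converges unconditionally in `L²(𝕋)`. -/
theorem hasSum_hilbertTransform (f : Lp ℂ 2 circleMeasure) :
    HasSum (fun k : ℤ => -Complex.I • (((k.sign : ℂ) * fourierCoeff f k) • fourierLp 2 k))
      (hilbertTransform f) := by
  have key : Summable fun k : ℤ =>
      (((k.sign : ℂ) * fourierCoeff f k) • fourierLp 2 k : Lp ℂ 2 circleMeasure) := by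
    have hmem : Memℓp (fun k : ℤ => (k.sign : ℂ) * fourierCoeff f k) 2 := by
      refine (lp.memℓp (fourierBasis.repr f)).mono' fun k => ?_
      rw [fourierBasis_repr, norm_mul]
      refine mul_le_of_le_one_left (norm_nonneg _) ?_
      rcases lt_trichotomy k 0 with h | h | h <;>
        simp [h, Int.sign_eq_neg_one_of_neg, Int.sign_eq_one_of_pos]
    have := (fourierBasis (T := 2 * π)).hasSum_repr_symm ⟨_, hmem⟩
    simpa using this.summable
  exact (key.hasSum).const_smul _

/-- The inclusion of the real space `L²(𝕋; ℝ)` into the complex space `L²(𝕋; ℂ)`. -/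
def realToComplexL2 (f : Lp ℝ 2 circleMeasure) : Lp ℂ 2 circleMeasure :=
  Complex.ofRealCLM.compLp f

/-- For `2 ≤ q`, the norm `‖H‖_{q,p}` of the Hilbert transform as an operator from the complex
space `L^q(𝕋)` (a subspace of `L²(𝕋)`) to `L^p(𝕋)`: the supremum of `‖H f‖_p` over all `f` with
`‖f‖_q ≤ 1`. It is `∞` if the operator is unbounded. -/
def hilbertNorm (q p : ℝ≥0∞) : ℝ≥0∞ :=
  ⨆ (f : Lp ℂ 2 circleMeasure) (_ : eLpNorm f q circleMeasure ≤ 1),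
    eLpNorm (hilbertTransform f) p circleMeasure

/-- For `2 ≤ q`, the norm `‖H_ℝ‖_{q,p}` of the Hilbert transform restricted to the real
space `L^q(𝕋; ℝ)`. -/
def realHilbertNorm (q p : ℝ≥0∞) : ℝ≥0∞ :=
  ⨆ (f : Lp ℝ 2 circleMeasure) (_ : eLpNorm f q circleMeasure ≤ 1),
    eLpNorm (hilbertTransform (realToComplexL2 f)) p circleMeasure

end

/-!
# The growth of the norm of the Hilbert transform from `L^∞` to `L^p`

*Upper bound.* If `q` is a trigonometric polynomial with `|q| ≤ M` and `w` is a unimodular number,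
then `Re (w q)` and `Re (w H q)` are, up to an additive constant in the second one, the real and
imaginary parts of an analytic polynomial `P` on the circle. Taking real parts in the mean value
property of `exp (-i α P)` gives `∫ exp (α Re (w H q)) ≤ 1 / cos (α M)` whenever `α M < π / 2`
(`integral_exp_im_polynomial_le`). Finitely many directions `w` control the modulus of a complex
number up to a factor `t > 1` (`exists_finset_norm_le_mul_re`), so the loss incurred by passing from
real to complex functions is only a multiplicative constant: `∫ exp (β |H q|) ≤ K` for every
`β < π / 2`. Since `x ^ p ≤ (p / (e β)) ^ p * exp (β x)`, this yields
`‖H q‖_p ≤ p / (e β) * K ^ (1 / p)`. Such `q`, with `M > 1`, are `L²`-dense enough to reach the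
whole unit ball of `L^∞` (`mem_closure_toL2_image`), and the `L^p` norm is lower semicontinuous with
respect to `L²` convergence; hence `hilbertNorm_le`. Now let `p → ∞` and then `β → π / 2`.

*Lower bound.* For `0 < δ < 1` the function `-log (1 - (1 - δ) ζ)` is analytic and vanishes at `0`,
its imaginary part is bounded by `π / 2`, and its real part is at least `log (1 / (2 δ))` on the arc
`|θ| ≤ δ`. So the real function `f = (2 / π) Im (-log (1 - (1 - δ) ζ))` is bounded by `1`, while
`|H f| ≥ 2 p / π` on an arc of measure `δ / π` when `δ = exp (-p) / 2`. This gives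
`‖H f‖_p ≥ (2 p / (π e)) * (2 π) ^ (-1 / p)` (`le_realHilbertNorm`).
-/

/-! ### The Hilbert transform as a Fourier multiplier -/

theorem inner_fourierLp_self_eq_ite (j k : ℤ) :
    inner ℂ (fourierLp 2 j : Lp ℂ 2 circleMeasure) (fourierLp 2 k) = if j = k then 1 else 0 :=
  orthonormal_iff_ite.1 (orthonormal_fourier (T := 2 * π)) j k

/-- Elements of `L²(𝕋)` are determined by their Fourier coefficients, written as inner products. -/
theorem ext_inner_fourierLp {f g : Lp ℂ 2 circleMeasure}
    (h : ∀ k, inner ℂ (fourierLp 2 k) f = inner ℂ (fourierLp 2 k) g) : f = g := by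
  apply fourierBasis.repr.injective
  apply lp.ext
  funext k
  have := h k
  rwa [← coe_fourierBasis, ← HilbertBasis.repr_apply_apply, ← HilbertBasis.repr_apply_apply] at this

theorem inner_fourierLp_eq_fourierCoeff (f : Lp ℂ 2 circleMeasure) (k : ℤ) :
    inner ℂ (fourierLp 2 k) f = fourierCoeff f k := by
  rw [← fourierBasis_repr, HilbertBasis.repr_apply_apply, coe_fourierBasis]

/-- The Hilbert transform is the Fourier multiplier with symbol `-i sign k`. -/
theorem inner_fourierLp_hilbertTransform (f : Lp ℂ 2 circleMeasure) (k : ℤ) :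
    inner ℂ (fourierLp 2 k) (hilbertTransform f)
      = -Complex.I * (k.sign : ℂ) * inner ℂ (fourierLp 2 k) f := by
  have h := (hasSum_hilbertTransform f).mapL (innerSL ℂ (fourierLp 2 k : Lp ℂ 2 circleMeasure))
  refine h.unique ?_
  convert hasSum_single k ?_ using 1
  · rw [innerSL_apply_apply, inner_smul_right, inner_smul_right, inner_fourierLp_self_eq_ite,
      inner_fourierLp_eq_fourierCoeff]
    simp [mul_assoc]
  · intro j hj
    rw [innerSL_apply_apply, inner_smul_right, inner_smul_right, inner_fourierLp_self_eq_ite,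
      if_neg hj.symm]
    simp

theorem norm_hilbertTransform_le (f : Lp ℂ 2 circleMeasure) : ‖hilbertTransform f‖ ≤ ‖f‖ := by
  rw [← sq_le_sq₀ (norm_nonneg _) (norm_nonneg _)]
  have h := fun f : Lp ℂ 2 circleMeasure => hasSum_sq_fourierCoeff f
  -- Parseval's identity, read as a formula for the norm
  have e (g : Lp ℂ 2 circleMeasure) : ∫ t, ‖g t‖ ^ 2 ∂circleMeasure = ‖g‖ ^ 2 := by
    have h3 := congr_arg RCLike.re (L2.inner_def (𝕜 := ℂ) g g)
    rw [← integral_re] at h3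
    · simp only [← norm_sq_eq_re_inner] at h3
      exact h3.symm
    · exact L2.integrable_inner g g
  simp only [e] at h
  refine hasSum_le (fun k => ?_) (h (hilbertTransform f)) (h f)
  rw [← inner_fourierLp_eq_fourierCoeff, ← inner_fourierLp_eq_fourierCoeff,
    inner_fourierLp_hilbertTransform, norm_mul, norm_mul, norm_neg, Complex.norm_I, one_mul]
  gcongr
  refine mul_le_of_le_one_left (norm_nonneg _) ?_
  rcases lt_trichotomy k 0 with h | h | h <;>
    simp [h, Int.sign_eq_neg_one_of_neg, Int.sign_eq_one_of_pos]

/-- The Hilbert transform as a continuous linear operator on `L²(𝕋)`. -/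
noncomputable def hilbertCLM : Lp ℂ 2 circleMeasure →L[ℂ] Lp ℂ 2 circleMeasure :=
  LinearMap.mkContinuous
    { toFun := hilbertTransform
      map_add' := fun f g => ext_inner_fourierLp fun k => by
        simp only [inner_add_right, inner_fourierLp_hilbertTransform, mul_add]
      map_smul' := fun c f => ext_inner_fourierLp fun k => by
        simp only [inner_smul_right, inner_fourierLp_hilbertTransform, RingHom.id_apply]
        ring }
    1 fun f => (norm_hilbertTransform_le f).trans_eq (one_mul _).symm

theorem hilbertCLM_apply (f : Lp ℂ 2 circleMeasure) : hilbertCLM f = hilbertTransform f := rfl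

theorem hilbertCLM_fourierLp (k : ℤ) :
    hilbertCLM (fourierLp 2 k) = (-Complex.I * (k.sign : ℂ)) • fourierLp 2 k := by
  refine ext_inner_fourierLp fun j => ?_
  rw [hilbertCLM_apply, inner_fourierLp_hilbertTransform, inner_smul_right,
    inner_fourierLp_self_eq_ite]
  split_ifs with h
  · rw [h]
  · simp

/-- The inclusion of the continuous functions into `L²(𝕋)`. -/
noncomputable abbrev toL2 : C(AddCircle (2 * π), ℂ) →L[ℂ] Lp ℂ 2 circleMeasure :=
  ContinuousMap.toLp 2 circleMeasure ℂ

/-! ### Conjugates of trigonometric polynomials -/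

theorem hilbertCLM_toL2_smul_fourier (c : ℂ) {k : ℤ} (hk : 0 < k) :
    hilbertCLM (toL2 (c • fourier k)) = toL2 (-Complex.I • c • fourier k) := by
  rw [map_smul, map_smul, map_smul, map_smul, hilbertCLM_fourierLp, Int.sign_eq_one_of_pos hk,
    Int.cast_one, mul_one, smul_comm]

theorem star_smul_fourier (c : ℂ) (k : ℤ) :
    star (c • (fourier k : C(AddCircle (2 * π), ℂ))) = star c • fourier (-k) := by
  ext x
  simp only [ContinuousMap.star_apply, ContinuousMap.smul_apply, smul_eq_mul, star_mul',
    fourier_neg]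
  rfl

theorem hilbertCLM_toL2_star_smul_fourier (c : ℂ) {k : ℤ} (hk : 0 < k) :
    hilbertCLM (toL2 (star (c • fourier k))) = toL2 (Complex.I • star (c • fourier k)) := by
  rw [star_smul_fourier, map_smul, map_smul, map_smul, map_smul, hilbertCLM_fourierLp,
    Int.sign_eq_neg_one_of_neg (by omega), smul_comm]
  simp

theorem hilbertCLM_toL2_smul_fourier_zero (c : ℂ) :
    hilbertCLM (toL2 (c • fourier 0)) = 0 := by
  rw [map_smul, map_smul, hilbertCLM_fourierLp]
  simp

/-- On analytic polynomials, `H A = -i (A - A(0))`. -/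
theorem hilbertCLM_toL2_polynomial (A : Polynomial ℂ) :
    hilbertCLM (toL2 A.toAddCircle)
      = toL2 (-Complex.I • (A - Polynomial.C (A.coeff 0)).toAddCircle) := by
  induction A using Polynomial.induction_on' with
  | add p q hp hq =>
    rw [Polynomial.coeff_add, map_add Polynomial.C, add_sub_add_comm, map_add, map_add, map_add, hp,
      hq, map_add, smul_add, map_add]
  | monomial n c =>
    rcases n.eq_zero_or_pos with rfl | hn
    · rw [Polynomial.toAddCircle_monomial_eq_smul_fourier]
      simpa using hilbertCLM_toL2_smul_fourier_zero c
    · rw [Polynomial.coeff_monomial, if_neg hn.ne', map_zero, sub_zero,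
        Polynomial.toAddCircle_monomial_eq_smul_fourier]
      exact hilbertCLM_toL2_smul_fourier c (by exact_mod_cast hn)

/-- On conjugates of analytic polynomials, `H (conj A) = i conj (A - A(0))`. -/
theorem hilbertCLM_toL2_star_polynomial (A : Polynomial ℂ) :
    hilbertCLM (toL2 (star A.toAddCircle))
      = toL2 (Complex.I • star (A - Polynomial.C (A.coeff 0)).toAddCircle) := by
  induction A using Polynomial.induction_on' with
  | add p q hp hq =>
    rw [Polynomial.coeff_add, map_add Polynomial.C, add_sub_add_comm, map_add, star_add, map_add,
      map_add, hp, hq, map_add, star_add, smul_add, map_add]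
  | monomial n c =>
    rcases n.eq_zero_or_pos with rfl | hn
    · rw [Polynomial.toAddCircle_monomial_eq_smul_fourier, Nat.cast_zero, star_smul_fourier]
      simpa using hilbertCLM_toL2_smul_fourier_zero (star c)
    · rw [Polynomial.coeff_monomial, if_neg hn.ne', map_zero, sub_zero,
        Polynomial.toAddCircle_monomial_eq_smul_fourier]
      exact hilbertCLM_toL2_star_smul_fourier c (by exact_mod_cast hn)

/-- A trigonometric polynomial is the sum of an analytic and an antianalytic polynomial. -/
theorem exists_polynomial_add_star_polynomial {q : C(AddCircle (2 * π), ℂ)}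
    (hq : q ∈ Submodule.span ℂ (Set.range (fourier (T := 2 * π)))) :
    ∃ A B : Polynomial ℂ, q = A.toAddCircle + star B.toAddCircle := by
  induction hq using Submodule.span_induction with
  | mem x hx =>
    obtain ⟨k, rfl⟩ := hx
    rcases le_total 0 k with hk | hk
    · obtain ⟨n, rfl⟩ := Int.eq_ofNat_of_zero_le hk
      exact ⟨Polynomial.X ^ n, 0, by simp [Polynomial.toAddCircle_X_pow_eq_fourier]⟩
    · obtain ⟨n, hn⟩ := Int.exists_eq_neg_ofNat hk
      refine ⟨0, Polynomial.X ^ n, ?_⟩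
      have := star_smul_fourier 1 n
      rw [one_smul, star_one, one_smul] at this
      rw [map_zero, zero_add, Polynomial.toAddCircle_X_pow_eq_fourier, this, hn]
  | zero => exact ⟨0, 0, by simp⟩
  | add x y _ _ hx hy =>
    obtain ⟨A, B, rfl⟩ := hx
    obtain ⟨A', B', rfl⟩ := hy
    exact ⟨A + A', B + B', by rw [map_add, map_add, star_add]; abel⟩
  | smul c x _ hx =>
    obtain ⟨A, B, rfl⟩ := hx
    exact ⟨c • A, star c • B, by rw [map_smul, map_smul, star_smul, star_star, smul_add]⟩

theorem toAddCircle_apply (P : Polynomial ℂ) (x : AddCircle (2 * π)) :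
    P.toAddCircle x = P.eval (x.toCircle : ℂ) := by
  simp only [Polynomial.toAddCircle]
  induction P using Polynomial.induction_on' with
  | add p q hp hq => rw [map_add, ContinuousMap.add_apply, hp, hq, Polynomial.eval_add]
  | monomial n c => simp [Polynomial.aeval_monomial, Algebra.algebraMap_eq_smul_one]

/-- The mean value property of the entire function `exp ∘ P` on the unit circle. -/
theorem integral_exp_polynomial (P : Polynomial ℂ) :
    ∫ x, Complex.exp (P.toAddCircle x) ∂circleMeasure = Complex.exp (P.coeff 0) := by
  have h : DiffContOnCl ℂ (fun z => Complex.exp (P.eval z)) (Metric.ball 0 |1|) :=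
    (P.differentiable.cexp).diffContOnCl
  have := h.circleAverage
  rw [Polynomial.coeff_zero_eq_eval_zero, ← this, AddCircle.integral_haarAddCircle,
    Real.circleAverage, ← AddCircle.intervalIntegral_preimage (2 * π) 0]
  simp [toAddCircle_apply, AddCircle.toCircle, circleMap]

/-- Exponential integrability of the conjugate function: if `|Re P| ≤ M` on the circle, then the
normalized conjugate function `Im P - Im P(0)` of `Re P` has exponential moments of every order
`α < π / (2 M)`. -/
theorem integral_exp_im_polynomial_le (P : Polynomial ℂ) {M α : ℝ} (hα : 0 ≤ α)
    (hM : ∀ x, |(P.toAddCircle x).re| ≤ M) (hαM : α * M < π / 2) :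
    ∫ x, Real.exp (α * ((P.toAddCircle x).im - (P.coeff 0).im)) ∂circleMeasure
      ≤ (Real.cos (α * M))⁻¹ := by
  have hM0 : 0 ≤ M := (abs_nonneg _).trans (hM 0)
  have hcos : 0 < Real.cos (α * M) :=
    Real.cos_pos_of_mem_Ioo ⟨by have := mul_nonneg hα hM0; linarith [Real.pi_pos], hαM⟩
  -- `exp R` has modulus `exp (α (Im P - Im P(0)))` and argument `-α Re P`
  set R : Polynomial ℂ := Polynomial.C (-Complex.I * α) *
    (P - Polynomial.C (Complex.I * (P.coeff 0).im)) with hR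
  have hRx (x) : R.toAddCircle x
      = -Complex.I * α * (P.toAddCircle x - Complex.I * (P.coeff 0).im) := by
    simp [hR, toAddCircle_apply]
  have hint := congr_arg Complex.re (integral_exp_polynomial R)
  have hintg : Integrable (fun x => Complex.exp (R.toAddCircle x)) circleMeasure :=
    ((Complex.continuous_exp.comp R.toAddCircle.continuous).integrable_of_hasCompactSupport
      (HasCompactSupport.of_compactSpace _))
  have hre : (∫ x, Complex.exp (R.toAddCircle x) ∂circleMeasure).re
      = ∫ x, (Complex.exp (R.toAddCircle x)).re ∂circleMeasure := by
    exact (integral_re hintg).symm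
  rw [hre] at hint
  -- `R(0) = -i α Re P(0)` is purely imaginary
  have hle : (Complex.exp (R.coeff 0)).re ≤ 1 := by
    have h0 : (R.coeff 0).re = 0 := by
      simp [hR, Polynomial.coeff_zero_eq_eval_zero]
    rw [Complex.exp_re, h0, Real.exp_zero, one_mul]
    exact Real.cos_le_one _
  rw [← one_div, le_div_iff₀ hcos, ← integral_mul_const]
  refine le_trans ?_ (hint.trans_le hle)
  refine integral_mono ?_ hintg.re fun x => ?_
  · refine Continuous.integrable_of_hasCompactSupport ?_ (HasCompactSupport.of_compactSpace _)
    fun_prop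
  · rw [hRx, Complex.exp_re]
    have e1 : (-Complex.I * α * (P.toAddCircle x - Complex.I * (P.coeff 0).im)).re
        = α * ((P.toAddCircle x).im - (P.coeff 0).im) := by
      simp [mul_assoc]
    have e2 : (-Complex.I * α * (P.toAddCircle x - Complex.I * (P.coeff 0).im)).im
        = -(α * (P.toAddCircle x).re) := by
      simp [mul_assoc]
    rw [e1, e2, Real.cos_neg]
    gcongr
    rw [← Real.cos_abs (α * (P.toAddCircle x).re), abs_mul, abs_of_nonneg hα]
    refine Real.cos_le_cos_of_nonneg_of_le_pi (by positivity) (by linarith [Real.pi_pos]) ?_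
    gcongr
    exact hM x

/-- The Hilbert transform of a trigonometric polynomial bounded by `M` has exponential moments of
every order `α < π / (2 M)` in every direction `w` of the complex plane. -/
theorem exists_hilbertCLM_eq_toL2 {q : C(AddCircle (2 * π), ℂ)}
    (hq : q ∈ Submodule.span ℂ (Set.range (fourier (T := 2 * π)))) {M α : ℝ} (hα : 0 ≤ α)
    (hM : ‖q‖ ≤ M) (hαM : α * M < π / 2) :
    ∃ g : C(AddCircle (2 * π), ℂ), hilbertCLM (toL2 q) = toL2 g ∧
      ∀ w : ℂ, ‖w‖ = 1 →
        ∫ x, Real.exp (α * (w * g x).re) ∂circleMeasure ≤ (Real.cos (α * M))⁻¹ := by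
  obtain ⟨A, B, rfl⟩ := exists_polynomial_add_star_polynomial hq
  refine ⟨-Complex.I • (A - Polynomial.C (A.coeff 0)).toAddCircle +
    Complex.I • star (B - Polynomial.C (B.coeff 0)).toAddCircle, ?_, fun w hw => ?_⟩
  · rw [map_add, map_add, hilbertCLM_toL2_polynomial, hilbertCLM_toL2_star_polynomial, map_add]
  · have key := integral_exp_im_polynomial_le
      (Polynomial.C w * A + Polynomial.C (star w) * B) (M := M) hα (fun x => ?_) hαM
    · convert key using 5 with x
      simp [toAddCircle_apply]
      ring
    · have h1 : ((Polynomial.C w * A + Polynomial.C (star w) * B).toAddCircle x).re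
          = (w * (A.toAddCircle + star B.toAddCircle) x).re := by
        simp [toAddCircle_apply]
        ring
      rw [h1]
      refine (Complex.abs_re_le_norm _).trans ?_
      rw [norm_mul, hw, one_mul]
      exact (ContinuousMap.norm_coe_le_norm _ x).trans hM

/-- The modulus of a complex number is controlled, up to a factor `t > 1`, by its components in
finitely many directions. -/
theorem exists_finset_norm_le_mul_re {t : ℝ} (ht : 1 < t) :
    ∃ S : Finset ℂ, (∀ w ∈ S, ‖w‖ = 1) ∧ ∀ z : ℂ, ∃ w ∈ S, ‖z‖ ≤ t * (w * z).re := by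
  have ht0 : 0 < t := by linarith
  obtain ⟨S, hS, hfin, hcov⟩ := Metric.finite_approx_of_totallyBounded
    (isCompact_sphere (0 : ℂ) 1).totallyBounded (1 - t⁻¹)
    (sub_pos.2 (inv_lt_one_of_one_lt₀ ht))
  -- if `s` is unimodular and `1 - t⁻¹`-close to `u = z / ‖z‖`, then `w = conj s` is a good direction
  have hcov' (u : ℂ) (hu : ‖u‖ = 1) : ∃ s ∈ S, ‖u - s‖ < 1 - t⁻¹ := by
    have := hcov (show u ∈ Metric.sphere (0 : ℂ) 1 by simpa using hu)
    simpa [dist_eq_norm] using this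
  have hS' (s : ℂ) (hs : s ∈ S) : ‖s‖ = 1 := by simpa using hS hs
  classical
  refine ⟨hfin.toFinset.image star, fun w hw => ?_, fun z => ?_⟩
  · obtain ⟨s, hs, rfl⟩ := Finset.mem_image.1 hw
    rw [norm_star]
    exact hS' s (by simpa using hs)
  · have key (u : ℂ) (hu : ‖u‖ = 1) : ∃ s ∈ S, t⁻¹ ≤ (star s * u).re := by
      obtain ⟨s, hs, h⟩ := hcov' u hu
      refine ⟨s, hs, ?_⟩
      have h1 : star s * u - 1 = star s * (u - s) := by
        have : star s * s = 1 := by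
          simp [Complex.conj_mul', hS' s hs]
        rw [mul_sub, this]
      have h2 : ‖star s * u - 1‖ < 1 - t⁻¹ := by
        rwa [h1, norm_mul, norm_star, hS' s hs, one_mul]
      have h3 := (abs_le.1 ((Complex.abs_re_le_norm (star s * u - 1)).trans h2.le)).1
      rw [Complex.sub_re, Complex.one_re] at h3
      linarith
    rcases eq_or_ne z 0 with rfl | hz
    · obtain ⟨s, hs, -⟩ := key 1 (by simp)
      exact ⟨star s, Finset.mem_image_of_mem _ (by simpa using hs), by simp⟩
    · have hz' : 0 < ‖z‖ := norm_pos_iff.2 hz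
      obtain ⟨s, hs, h⟩ := key ((‖z‖⁻¹ : ℝ) * z) (by simp [hz'.ne'])
      refine ⟨star s, Finset.mem_image_of_mem _ (by simpa using hs), ?_⟩
      rw [mul_left_comm, Complex.re_ofReal_mul] at h
      rw [inv_le_iff_one_le_mul₀ ht0] at h
      field_simp at h
      linarith

/-! ### The upper bound -/

/-- The function `x ^ p * exp (-β x)` is maximal at `x = p / β`. -/
theorem rpow_le_mul_exp {x p β : ℝ} (hx : 0 ≤ x) (hp : 0 < p) (hβ : 0 < β) :
    x ^ p ≤ (p / (Real.exp 1 * β)) ^ p * Real.exp (β * x) := by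
  have h1 : x ≤ p / (Real.exp 1 * β) * Real.exp (β * x / p) := by
    -- `e y ≤ exp y` for `y = β x / p`
    have := Real.add_one_le_exp (β * x / p - 1)
    rw [sub_add_cancel, Real.exp_sub] at this
    calc x = p / β * (β * x / p) := by field_simp
      _ ≤ p / β * (Real.exp (β * x / p) / Real.exp 1) := by gcongr
      _ = _ := by field_simp
  calc x ^ p ≤ (p / (Real.exp 1 * β) * Real.exp (β * x / p)) ^ p :=
        Real.rpow_le_rpow hx h1 hp.le
    _ = _ := by
      rw [Real.mul_rpow (by positivity) (by positivity), ← Real.exp_mul]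
      congr 2
      field_simp

theorem eLpNorm_le_of_integral_exp_le {g : C(AddCircle (2 * π), ℂ)} {p β K : ℝ} (hp : 0 < p)
    (hβ : 0 < β) (hK : ∫ x, Real.exp (β * ‖g x‖) ∂circleMeasure ≤ K) :
    eLpNorm g (ENNReal.ofReal p) circleMeasure
      ≤ ENNReal.ofReal (p / (Real.exp 1 * β) * K ^ (1 / p)) := by
  have hK0 : 0 ≤ K := (integral_nonneg fun x => (Real.exp_pos _).le).trans hK
  rw [eLpNorm_eq_lintegral_rpow_enorm_toReal (by simpa using hp) ENNReal.ofReal_ne_top,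
    ENNReal.toReal_ofReal hp.le]
  have hintg : Integrable (fun x => (p / (Real.exp 1 * β)) ^ p * Real.exp (β * ‖g x‖))
      circleMeasure := by
    refine Continuous.integrable_of_hasCompactSupport ?_ (HasCompactSupport.of_compactSpace _)
    fun_prop
  calc (∫⁻ x, ‖g x‖ₑ ^ p ∂circleMeasure) ^ (1 / p)
      ≤ (∫⁻ x, ENNReal.ofReal ((p / (Real.exp 1 * β)) ^ p * Real.exp (β * ‖g x‖))
          ∂circleMeasure) ^ (1 / p) := by
        gcongr with x
        rw [← ofReal_norm, ENNReal.ofReal_rpow_of_nonneg (norm_nonneg _) hp.le]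
        exact ENNReal.ofReal_le_ofReal (rpow_le_mul_exp (norm_nonneg _) hp hβ)
    _ ≤ (ENNReal.ofReal ((p / (Real.exp 1 * β)) ^ p * K)) ^ (1 / p) := by
        rw [← ofReal_integral_eq_lintegral_ofReal hintg
          (Eventually.of_forall fun x => by positivity), integral_const_mul]
        gcongr
    _ = _ := by
        rw [ENNReal.ofReal_rpow_of_nonneg (by positivity) (by positivity),
          Real.mul_rpow (by positivity) hK0, ← Real.rpow_mul (by positivity), mul_one_div_cancel hp.ne',
          Real.rpow_one]

/-- Every `f` in the unit ball of `L^∞` is an `L²` limit of trigonometric polynomials bounded by a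
given `M > 1`. -/
theorem mem_closure_toL2_image {f : Lp ℂ 2 circleMeasure} (hf : eLpNorm f ∞ circleMeasure ≤ 1)
    {M : ℝ} (hM : 1 < M) :
    f ∈ closure (toL2 '' {q | q ∈ Submodule.span ℂ (Set.range (fourier (T := 2 * π))) ∧
      ‖q‖ ≤ M}) := by
  have hdense : Dense (Submodule.span ℂ (Set.range (fourier (T := 2 * π))) :
      Set C(AddCircle (2 * π), ℂ)) :=
    (Submodule.dense_iff_topologicalClosure_eq_top).2 span_fourier_closure_eq_top
  have h1 : {h : C(AddCircle (2 * π), ℂ) | ‖h‖ ≤ 1} ⊆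
      closure {q | q ∈ Submodule.span ℂ (Set.range (fourier (T := 2 * π))) ∧ ‖q‖ ≤ M} := by
    intro h hh
    have hmem : h ∈ Metric.ball (0 : C(AddCircle (2 * π), ℂ)) M := by
      simpa using lt_of_le_of_lt hh hM
    refine closure_mono ?_ (hdense.open_subset_closure_inter Metric.isOpen_ball hmem)
    rintro q ⟨hq1, hq2⟩
    exact ⟨hq2, (mem_ball_zero_iff.1 hq1).le⟩
  have h2 : f ∈ closure (toL2 '' {h : C(AddCircle (2 * π), ℂ) | ‖h‖ ≤ 1}) := by
    rw [Metric.mem_closure_iff]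
    intro ε hε
    obtain ⟨h, hh⟩ := (ContinuousMap.toLp_denseRange ℂ circleMeasure ℂ
      (p := 2) (by norm_num)).exists_dist_lt f (half_pos hε)
    have hpos (x) : (0 : ℝ) < max 1 ‖h x‖ := lt_max_of_lt_left one_pos
    -- the radial retraction of `h` onto the unit disc is at most twice as far from `f` as `h` is
    let r : C(AddCircle (2 * π), ℂ) :=
      ⟨fun x => ((max 1 ‖h x‖)⁻¹ : ℝ) • h x,
        (Continuous.inv₀ (by fun_prop) fun x => (hpos x).ne').smul (by fun_prop)⟩
    have hr (x) : r x = ((max 1 ‖h x‖)⁻¹ : ℝ) • h x := rfl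
    refine ⟨toL2 r, ⟨r, ?_, rfl⟩, ?_⟩
    · refine (ContinuousMap.norm_le _ zero_le_one).2 fun x => ?_
      rw [hr, norm_smul, Real.norm_of_nonneg (inv_nonneg.2 (hpos x).le),
        inv_mul_le_iff₀ (hpos x), mul_one]
      exact le_max_right _ _
    · rw [dist_eq_norm] at hh ⊢
      refine lt_of_le_of_lt (b := 2 * ‖f - toL2 h‖) ?_ (by linarith)
      refine Lp.norm_le_mul_norm_of_ae_le_mul ?_
      have hf1 : ∀ᵐ x ∂circleMeasure, ‖f x‖ ≤ 1 := by
        rw [eLpNorm_exponent_top] at hf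
        filter_upwards [ae_le_eLpNormEssSup (f := f) (μ := circleMeasure)] with x hx
        have := hx.trans hf
        rwa [← ofReal_norm, ENNReal.ofReal_le_one] at this
      filter_upwards [hf1, Lp.coeFn_sub f (toL2 h), Lp.coeFn_sub f (toL2 r),
        ContinuousMap.coeFn_toLp (p := 2) (𝕜 := ℂ) circleMeasure h,
        ContinuousMap.coeFn_toLp (p := 2) (𝕜 := ℂ) circleMeasure r] with x hx e1 e2 e3 e4
      rw [e1, e2, Pi.sub_apply, Pi.sub_apply, e3, e4]
      have h3 : ‖h x - r x‖ ≤ ‖f x - h x‖ := by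
        have h4 : h x - r x = (1 - (max 1 ‖h x‖)⁻¹ : ℝ) • h x := by rw [hr, sub_smul, one_smul]
        rw [h4, norm_smul, Real.norm_of_nonneg (by
          rw [sub_nonneg]; exact inv_le_one_of_one_le₀ (le_max_left _ _))]
        rcases le_total ‖h x‖ 1 with h5 | h5
        · rw [max_eq_left h5]; simp
        · rw [max_eq_right h5, sub_mul, inv_mul_cancel₀ (by linarith), one_mul]
          have := norm_sub_norm_le (h x) (f x)
          rw [norm_sub_rev] at this
          linarith
      calc ‖f x - r x‖ = ‖(f x - h x) + (h x - r x)‖ := by congr 1; ring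
        _ ≤ ‖f x - h x‖ + ‖h x - r x‖ := norm_add_le _ _
        _ ≤ 2 * ‖f x - h x‖ := by linarith
  refine closure_minimal ?_ isClosed_closure h2
  refine (Set.image_mono h1).trans ?_
  exact image_closure_subset_closure_image toL2.continuous

/-- Lower semicontinuity of the `L^p` norm with respect to `L²` convergence. -/
theorem isClosed_setOf_eLpNorm_le (p C : ℝ≥0∞) :
    IsClosed {g : Lp ℂ 2 circleMeasure | eLpNorm g p circleMeasure ≤ C} := by
  refine isSeqClosed_iff_isClosed.1 fun u g hu hug => ?_
  exact eLpNorm_le_of_tendstoInMeasure (Eventually.of_forall hu)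
    (tendstoInMeasure_of_tendsto_Lp hug) fun n => Lp.aestronglyMeasurable _

/-- Upper bound for the norm `‖H‖_{∞,p}`, with a constant `K = K(β)` independent of `p`. -/
theorem hilbertNorm_le {β : ℝ} (hβ : 0 < β) (hβ' : β < π / 2) :
    ∃ K : ℝ, 0 < K ∧ ∀ p : ℝ, 0 < p → hilbertNorm ∞ (ENNReal.ofReal p)
      ≤ ENNReal.ofReal (p / (Real.exp 1 * β) * K ^ (1 / p)) := by
  -- one factor `t` pays for the finite net of directions, the other for the bound `M = t` on the
  -- approximating trigonometric polynomials
  obtain ⟨t, ht, htβ⟩ : ∃ t : ℝ, 1 < t ∧ β * t * t < π / 2 := by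
    have : Tendsto (fun t : ℝ => β * t * t) (𝓝[>] 1) (𝓝 (β * 1 * 1)) :=
      (Continuous.tendsto (by fun_prop) 1).mono_left nhdsWithin_le_nhds
    have h1 := this.eventually_lt_const (show β * 1 * 1 < π / 2 by simpa using hβ')
    obtain ⟨t, h2, h3⟩ := (h1.and self_mem_nhdsWithin).exists
    exact ⟨t, h3, h2⟩
  have ht0 : 0 < t := by linarith
  obtain ⟨S, hS, hS'⟩ := exists_finset_norm_le_mul_re ht
  have hcos : 0 < Real.cos (β * t * t) :=
    Real.cos_pos_of_mem_Ioo ⟨by have : 0 < β * t * t := by positivity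
                                linarith [Real.pi_pos], htβ⟩
  have hSne : 0 < S.card := by
    obtain ⟨w, hw, -⟩ := hS' 0
    exact Finset.card_pos.2 ⟨w, hw⟩
  refine ⟨S.card * (Real.cos (β * t * t))⁻¹, by positivity, fun p hp => ?_⟩
  refine iSup₂_le fun f hf => ?_
  have hcl := (isClosed_setOf_eLpNorm_le (ENNReal.ofReal p) (ENNReal.ofReal
    (p / (Real.exp 1 * β) * (S.card * (Real.cos (β * t * t))⁻¹) ^ (1 / p)))).preimage
      hilbertCLM.continuous
  refine closure_minimal ?_ hcl (mem_closure_toL2_image hf ht)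
  rintro _ ⟨q, ⟨hq, hqM⟩, rfl⟩
  obtain ⟨g, hg, hexp⟩ := exists_hilbertCLM_eq_toL2 hq (by positivity) hqM htβ
  change eLpNorm (hilbertCLM (toL2 q)) _ _ ≤ _
  rw [hg, eLpNorm_congr_ae (ContinuousMap.coeFn_toLp (p := 2) (𝕜 := ℂ) circleMeasure g)]
  refine eLpNorm_le_of_integral_exp_le hp hβ ?_
  have hint (φ : AddCircle (2 * π) → ℝ) (hφ : Continuous φ) : Integrable φ circleMeasure :=
    hφ.integrable_of_hasCompactSupport (HasCompactSupport.of_compactSpace _)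
  calc ∫ x, Real.exp (β * ‖g x‖) ∂circleMeasure
      ≤ ∫ x, ∑ w ∈ S, Real.exp (β * t * (w * g x).re) ∂circleMeasure := by
        refine integral_mono (hint _ (by fun_prop)) (hint _ (by fun_prop)) fun x => ?_
        obtain ⟨w, hw, h⟩ := hS' (g x)
        refine le_trans ?_ (Finset.single_le_sum
          (f := fun w => Real.exp (β * t * (w * g x).re)) (fun _ _ => (Real.exp_pos _).le) hw)
        rw [mul_assoc β]
        dsimp only
        gcongr
    _ = ∑ w ∈ S, ∫ x, Real.exp (β * t * (w * g x).re) ∂circleMeasure :=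
        integral_finsetSum _ fun w _ => hint _ (by fun_prop)
    _ ≤ ∑ w ∈ S, (Real.cos (β * t * t))⁻¹ := Finset.sum_le_sum fun w hw => hexp w (hS w hw)
    _ = _ := by rw [Finset.sum_const, nsmul_eq_mul]

/-! ### The lower bound -/

theorem norm_fourier_one_sub_one_le (x : AddCircle (2 * π)) :
    ‖fourier 1 x - 1‖ ≤ ‖x‖ := by
  induction x using QuotientAddGroup.induction_on with
  | H r =>
    -- the representative of `r` modulo `2 π` of least absolute value
    set s : ℝ := r - round ((2 * π)⁻¹ * r) * (2 * π) with hs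
    have h : (s : AddCircle (2 * π)) = (r : AddCircle (2 * π)) := by
      rw [hs, AddCircle.coe_sub, ← zsmul_eq_mul, AddCircle.coe_zsmul, AddCircle.coe_period]
      simp
    have h2 : ‖(r : AddCircle (2 * π))‖ = ‖s‖ := AddCircle.norm_eq _
    change ‖fourier 1 (r : AddCircle (2 * π)) - 1‖ ≤ ‖(r : AddCircle (2 * π))‖
    rw [h2, ← h, fourier_coe_apply]
    convert Real.norm_exp_I_mul_ofReal_sub_one_le (x := s) using 4
    push_cast
    have : (π : ℂ) ≠ 0 := by exact_mod_cast Real.pi_ne_zero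
    field_simp

theorem norm_smul_fourier_one_lt_one {ρ : ℝ} (hρ : 0 ≤ ρ) (hρ' : ρ < 1) (x : AddCircle (2 * π)) :
    ‖(ρ : ℂ) * fourier 1 x‖ < 1 := by
  rw [norm_mul, Complex.norm_real, Real.norm_of_nonneg hρ, fourier_one, Circle.norm_coe, mul_one]
  exact hρ'

/-- The function `-log (1 - ρ ζ)` on the circle, as a uniformly convergent Fourier series with
frequencies `n ≥ 1`. -/
theorem exists_hasSum_neg_log {ρ : ℝ} (hρ : 0 ≤ ρ) (hρ' : ρ < 1) :
    ∃ G : C(AddCircle (2 * π), ℂ), (∀ x, G x = -Complex.log (1 - ρ * fourier 1 x)) ∧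
      HasSum (fun n : ℕ => ((ρ : ℂ) ^ (n + 1) / (n + 1)) •
        (fourier ((n + 1 : ℕ) : ℤ) : C(AddCircle (2 * π), ℂ))) G := by
  have hsum : Summable fun n : ℕ => ((ρ : ℂ) ^ (n + 1) / (n + 1)) •
      (fourier ((n + 1 : ℕ) : ℤ) : C(AddCircle (2 * π), ℂ)) := by
    refine Summable.of_norm_bounded (summable_geometric_of_lt_one hρ hρ') fun n => ?_
    rw [norm_smul, fourier_norm, mul_one, norm_div, norm_pow, Complex.norm_real,
      Real.norm_of_nonneg hρ]
    have h1 : ‖(n : ℂ) + 1‖ = n + 1 := by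
      rw [← Nat.cast_add_one, Complex.norm_natCast, Nat.cast_add_one]
    rw [h1]
    refine (div_le_self (by positivity) (by linarith [(n.cast_nonneg : (0 : ℝ) ≤ n)])).trans ?_
    exact pow_le_pow_of_le_one hρ hρ'.le n.le_succ
  refine ⟨_, fun x => ?_, hsum.hasSum⟩
  refine (ContinuousMap.hasSum_apply hsum.hasSum x).unique ?_
  convert Complex.hasSum_taylorSeries_neg_log' (norm_smul_fourier_one_lt_one hρ hρ' x) using 2 with n
  rw [ContinuousMap.smul_apply, smul_eq_mul, mul_pow, fourier_one, fourier_apply, natCast_zsmul,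
    AddCircle.toCircle_nsmul]
  push_cast
  ring

/-- `H G = -i G` for a uniformly convergent Fourier series `G` with frequencies `n ≥ 1`. -/
theorem hilbertCLM_toL2_of_hasSum {c : ℕ → ℂ} {G : C(AddCircle (2 * π), ℂ)}
    (h : HasSum (fun n : ℕ => c n • (fourier ((n + 1 : ℕ) : ℤ) : C(AddCircle (2 * π), ℂ))) G) :
    hilbertCLM (toL2 G) = toL2 (-Complex.I • G) := by
  refine ((h.mapL toL2).mapL hilbertCLM).unique ?_
  convert (h.const_smul (-Complex.I)).mapL toL2 using 2 with n
  exact hilbertCLM_toL2_smul_fourier _ (by positivity)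

/-- `H (conj G) = i conj G` for a uniformly convergent Fourier series `G` with frequencies `n ≥ 1`. -/
theorem hilbertCLM_toL2_star_of_hasSum {c : ℕ → ℂ} {G : C(AddCircle (2 * π), ℂ)}
    (h : HasSum (fun n : ℕ => c n • (fourier ((n + 1 : ℕ) : ℤ) : C(AddCircle (2 * π), ℂ))) G) :
    hilbertCLM (toL2 (star G)) = toL2 (Complex.I • star G) := by
  refine ((h.star.mapL toL2).mapL hilbertCLM).unique ?_
  convert (h.star.const_smul Complex.I).mapL toL2 using 2 with n
  exact hilbertCLM_toL2_star_smul_fourier _ (by positivity)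

theorem realToComplexL2_toLp (u : C(AddCircle (2 * π), ℝ)) (v : C(AddCircle (2 * π), ℂ))
    (h : ∀ x, v x = u x) :
    realToComplexL2 (ContinuousMap.toLp 2 circleMeasure ℝ u) = toL2 v := by
  apply Lp.ext
  filter_upwards [Complex.ofRealCLM.coeFn_compLp (ContinuousMap.toLp 2 circleMeasure ℝ u),
    ContinuousMap.coeFn_toLp (p := 2) (𝕜 := ℂ) circleMeasure v,
    ContinuousMap.coeFn_toLp (p := 2) (𝕜 := ℝ) circleMeasure u] with x h1 h2 h3
  rw [realToComplexL2, h1, h2, h3, h]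
  rfl

theorem circleMeasure_closedBall {δ : ℝ} (hδ : δ ≤ π) :
    circleMeasure (Metric.closedBall 0 δ) = ENNReal.ofReal (δ / π) := by
  have h := AddCircle.volume_closedBall (T := 2 * π) (x := 0) δ
  rw [AddCircle.volume_eq_smul_haarAddCircle, Measure.smul_apply, smul_eq_mul,
    min_eq_right (by linarith)] at h
  have h0 : ENNReal.ofReal (2 * π) ≠ 0 := by simp [Real.pi_pos]
  rw [← ENNReal.mul_right_inj h0 ENNReal.ofReal_ne_top, h, ← ENNReal.ofReal_mul (by positivity)]
  congr 1
  field_simp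

/-- Lower bound for the norm `‖H_ℝ‖_{∞,p}`, valid for every finite `p > 0`. The number under the
`p`-th root is the measure of the arc `|θ| ≤ exp (-p) / 2`. -/
theorem le_realHilbertNorm {p : ℝ} (hp : 0 < p) :
    ENNReal.ofReal (2 / π * p * (Real.exp (-p) / (2 * π)) ^ (1 / p))
      ≤ realHilbertNorm ∞ (ENNReal.ofReal p) := by
  have hπ := Real.pi_pos
  set δ := Real.exp (-p) / 2 with hδ
  have hδ0 : 0 < δ := by positivity
  have hexp : Real.exp (-p) < 1 := by rw [Real.exp_lt_one_iff]; linarith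
  obtain ⟨G, hG, hsum⟩ := exists_hasSum_neg_log (ρ := 1 - δ) (by linarith) (by linarith)
  have hz (x) := norm_smul_fourier_one_lt_one (ρ := 1 - δ) (by linarith) (by linarith) x
  -- the test function `u = (2 / π) Im G`, and its complex form `v = (G - conj G) / (π i)`
  let u : C(AddCircle (2 * π), ℝ) := ⟨fun x => 2 / π * (G x).im, by fun_prop⟩
  let v : C(AddCircle (2 * π), ℂ) := (π * Complex.I : ℂ)⁻¹ • (G - star G)
  have hπI : (π * Complex.I : ℂ) ≠ 0 := by simp
  have huv (x) : v x = u x := by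
    change (π * Complex.I : ℂ)⁻¹ * (G x - star (G x)) = ((2 / π * (G x).im : ℝ) : ℂ)
    have : G x - star (G x) = 2 * (G x).im * Complex.I := by
      apply Complex.ext <;> simp
      ring
    rw [this]
    push_cast
    field_simp
  have hu (x) : ‖u x‖ ≤ 1 := by
    have h1 : |(G x).im| ≤ π / 2 := by
      rw [hG, Complex.neg_im, abs_neg, Complex.log_im, Complex.abs_arg_le_pi_div_two_iff,
        Complex.sub_re, Complex.one_re, sub_nonneg]
      exact ((le_abs_self _).trans (Complex.abs_re_le_norm _)).trans (hz x).le
    change |2 / π * (G x).im| ≤ 1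
    rw [abs_mul, abs_of_pos (by positivity)]
    calc 2 / π * |(G x).im| ≤ 2 / π * (π / 2) := by gcongr
      _ = 1 := by field_simp
  have hH : hilbertTransform (realToComplexL2 (ContinuousMap.toLp 2 circleMeasure ℝ u))
      = toL2 ((-(π : ℂ)⁻¹) • (G + star G)) := by
    rw [realToComplexL2_toLp u v huv, ← hilbertCLM_apply, map_smul, map_smul, map_sub, map_sub,
      hilbertCLM_toL2_of_hasSum hsum, hilbertCLM_toL2_star_of_hasSum hsum, ← map_sub, ← map_smul]
    congr 1
    ext x
    simp only [ContinuousMap.smul_apply, ContinuousMap.sub_apply, ContinuousMap.add_apply,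
      smul_eq_mul]
    field_simp
    ring
  have hle : eLpNorm (ContinuousMap.toLp 2 circleMeasure ℝ u) ∞ circleMeasure ≤ 1 := by
    rw [eLpNorm_congr_ae (ContinuousMap.coeFn_toLp (p := 2) (𝕜 := ℝ) circleMeasure u)]
    refine (eLpNorm_le_of_ae_bound (C := 1) (Eventually.of_forall hu)).trans ?_
    simp
  refine le_trans ?_ (le_iSup₂_of_le (ContinuousMap.toLp 2 circleMeasure ℝ u) hle le_rfl)
  rw [hH, eLpNorm_congr_ae (ContinuousMap.coeFn_toLp (p := 2) (𝕜 := ℂ) circleMeasure _)]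
  -- Chebyshev's inequality at the level `2 p / π`
  refine le_trans ?_ (pow_mul_meas_ge_le_eLpNorm circleMeasure (by simpa using hp)
    ENNReal.ofReal_ne_top (ContinuousMap.continuous _).aestronglyMeasurable
    (ENNReal.ofReal ((2 / π * p) ^ p)))
  rw [ENNReal.toReal_ofReal hp.le]
  have hset : Metric.closedBall 0 δ ⊆ {x | ENNReal.ofReal ((2 / π * p) ^ p)
      ≤ ‖((-(π : ℂ)⁻¹) • (G + star G)) x‖ₑ ^ p} := by
    intro x hx
    rw [mem_closedBall_zero_iff] at hx
    have hval : ((-(π : ℂ)⁻¹) • (G + star G)) x = ((-(2 / π * (G x).re) : ℝ) : ℂ) := by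
      change (-(π : ℂ)⁻¹) * (G x + star (G x)) = _
      have : G x + star (G x) = 2 * (G x).re := by
        apply Complex.ext <;> simp
        ring
      rw [this]
      push_cast
      ring
    have hpos : 0 < ‖1 - ((1 - δ : ℝ) : ℂ) * fourier 1 x‖ := by
      rw [norm_pos_iff, sub_ne_zero]
      intro h
      have := hz x
      rw [← h, norm_one] at this
      exact lt_irrefl _ this
    have hnorm : ‖1 - ((1 - δ : ℝ) : ℂ) * fourier 1 x‖ ≤ Real.exp (-p) := by
      have e : 1 - ((1 - δ : ℝ) : ℂ) * fourier 1 x = -(fourier 1 x - 1) + δ * fourier 1 x := by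
        push_cast; ring
      rw [e]
      refine (norm_add_le _ _).trans ?_
      rw [norm_neg, norm_mul, Complex.norm_real, Real.norm_of_nonneg hδ0.le, fourier_one,
        Circle.norm_coe, ← fourier_one]
      have := (norm_fourier_one_sub_one_le x).trans hx
      linarith
    have hre : p ≤ (G x).re := by
      rw [hG, Complex.neg_re, Complex.log_re]
      have := Real.log_le_log hpos hnorm
      rw [Real.log_exp] at this
      linarith
    rw [Set.mem_ofPred_eq, hval, ← ofReal_norm, Complex.norm_real, norm_neg,
      Real.norm_of_nonneg (mul_nonneg (by positivity) (hp.le.trans hre)),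
      ENNReal.ofReal_rpow_of_nonneg (mul_nonneg (by positivity) (hp.le.trans hre)) hp.le]
    apply ENNReal.ofReal_le_ofReal
    gcongr
  calc ENNReal.ofReal (2 / π * p * (Real.exp (-p) / (2 * π)) ^ (1 / p))
      = (ENNReal.ofReal ((2 / π * p) ^ p) * ENNReal.ofReal (δ / π)) ^ (1 / p) := by
        rw [← ENNReal.ofReal_mul (by positivity),
          ENNReal.ofReal_rpow_of_nonneg (by positivity) (by positivity),
          Real.mul_rpow (by positivity) (by positivity), ← Real.rpow_mul (by positivity),
          mul_one_div_cancel hp.ne', Real.rpow_one, hδ, div_div]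
    _ ≤ _ := by
        rw [← circleMeasure_closedBall (by linarith [Real.pi_gt_three])]
        gcongr

/-! ### Asymptotics of the norms -/

theorem realHilbertNorm_le_hilbertNorm (q p : ℝ≥0∞) : realHilbertNorm q p ≤ hilbertNorm q p := by
  refine iSup₂_le fun f hf => ?_
  refine le_iSup₂_of_le (realToComplexL2 f) ?_ le_rfl
  refine le_trans (le_of_eq ?_) hf
  refine eLpNorm_congr_norm_ae ?_
  filter_upwards [Complex.ofRealCLM.coeFn_compLp f] with x hx
  rw [realToComplexL2, hx]
  simp

theorem theorem2 :
    Tendsto (fun p : ℝ => (ENNReal.ofReal p)⁻¹ * hilbertNorm ∞ (ENNReal.ofReal p)) atTop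
      (𝓝 (ENNReal.ofReal (2 / (π * Real.exp 1)))) ∧
    Tendsto (fun p : ℝ => (ENNReal.ofReal p)⁻¹ * realHilbertNorm ∞ (ENNReal.ofReal p)) atTop
      (𝓝 (ENNReal.ofReal (2 / (π * Real.exp 1)))) := by
  have hπ := Real.pi_pos
  have hroot {K : ℝ} (hK : 0 < K) : Tendsto (fun p : ℝ => K ^ (1 / p)) atTop (𝓝 1) := by
    have h := tendsto_const_nhds (x := K) |>.rpow (tendsto_inv_atTop_zero (𝕜 := ℝ)) (Or.inl hK.ne')
    simpa [one_div] using h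
  have hlow : Tendsto (fun p : ℝ => ENNReal.ofReal (2 / (π * Real.exp 1) * (2 * π)⁻¹ ^ (1 / p)))
      atTop (𝓝 (ENNReal.ofReal (2 / (π * Real.exp 1)))) := by
    have := (hroot (inv_pos.2 Real.two_pi_pos)).const_mul (2 / (π * Real.exp 1))
    rw [mul_one] at this
    exact ENNReal.tendsto_ofReal this
  have hlow' : ∀ p : ℝ, 0 < p → ENNReal.ofReal (2 / (π * Real.exp 1) * (2 * π)⁻¹ ^ (1 / p))
      ≤ (ENNReal.ofReal p)⁻¹ * realHilbertNorm ∞ (ENNReal.ofReal p) := by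
    intro p hp
    refine le_trans (le_of_eq ?_) (mul_le_mul_right (le_realHilbertNorm hp) _)
    rw [← ENNReal.ofReal_inv_of_pos hp, ← ENNReal.ofReal_mul (by positivity), div_eq_mul_inv
      (Real.exp (-p)), Real.mul_rpow (by positivity) (by positivity), ← Real.exp_mul]
    have : -p * (1 / p) = -1 := by field_simp
    rw [this, Real.exp_neg]
    congr 1
    field_simp
  have hmono : ∀ p : ℝ, (ENNReal.ofReal p)⁻¹ * realHilbertNorm ∞ (ENNReal.ofReal p)
      ≤ (ENNReal.ofReal p)⁻¹ * hilbertNorm ∞ (ENNReal.ofReal p) := fun p =>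
    mul_le_mul_right (realHilbertNorm_le_hilbertNorm _ _) _
  have hup : ∀ b, ENNReal.ofReal (2 / (π * Real.exp 1)) < b → ∀ᶠ p : ℝ in atTop,
      (ENNReal.ofReal p)⁻¹ * hilbertNorm ∞ (ENNReal.ofReal p) < b := by
    intro b hb
    have hlim : Tendsto (fun β : ℝ => ENNReal.ofReal (1 / (Real.exp 1 * β))) (𝓝[<] (π / 2))
        (𝓝 (ENNReal.ofReal (2 / (π * Real.exp 1)))) := by
      refine ENNReal.tendsto_ofReal ?_
      have : (2 / (π * Real.exp 1)) = 1 / (Real.exp 1 * (π / 2)) := by field_simp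
      rw [this]
      refine Tendsto.mono_left ?_ nhdsWithin_le_nhds
      exact ContinuousAt.tendsto (f := fun β : ℝ => 1 / (Real.exp 1 * β))
        (by fun_prop (disch := positivity))
    have hIoo : ∀ᶠ β : ℝ in 𝓝[<] (π / 2), β ∈ Set.Ioo 0 (π / 2) :=
      Ioo_mem_nhdsLT (by positivity)
    obtain ⟨β, hβb, hβ, hβ'⟩ := ((hlim.eventually_lt_const hb).and hIoo).exists
    obtain ⟨K, hK, hKp⟩ := hilbertNorm_le hβ hβ'
    have hlim2 : Tendsto (fun p : ℝ => ENNReal.ofReal (1 / (Real.exp 1 * β) * K ^ (1 / p))) atTop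
        (𝓝 (ENNReal.ofReal (1 / (Real.exp 1 * β)))) := by
      have := (hroot hK).const_mul (1 / (Real.exp 1 * β))
      rw [mul_one] at this
      exact ENNReal.tendsto_ofReal this
    filter_upwards [hlim2.eventually_lt_const hβb, eventually_gt_atTop 0] with p h1 hp
    refine lt_of_le_of_lt ((mul_le_mul_right (hKp p hp) _).trans_eq ?_) h1
    rw [← ENNReal.ofReal_inv_of_pos hp, ← ENNReal.ofReal_mul (by positivity)]
    congr 1
    field_simp
  constructor
  · refine tendsto_order.2 ⟨fun a ha => ?_, hup⟩
    filter_upwards [hlow.eventually_const_lt ha, eventually_gt_atTop 0] with p h1 hp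
    exact h1.trans_le ((hlow' p hp).trans (hmono p))
  · refine tendsto_order.2 ⟨fun a ha => ?_, fun b hb => ?_⟩
    · filter_upwards [hlow.eventually_const_lt ha, eventually_gt_atTop 0] with p h1 hp
      exact h1.trans_le (hlow' p hp)
    · filter_upwards [hup b hb] with p h1
      exact (hmono p).trans_lt h1
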